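/- **Setting.** Let $n,m,g\ge 1$ and $\tau\ge 0$ be integers and $\lambda\in(0,1)$. For distributions $D,D'$ let $\mathrm{LLR}(D,D')=\sup_E\left|\ln\frac{D(E)}{D'(E)}\right|$, the supremum being over events not null under both (with value $+\infty$ if exactly one of the probabilities is $0$), and let $\mathrm{SD}$ be statistical distance. For $r>0$, $\text{Pólya}(r,\lambda)$ gives mass $\binom{k+r-1}{k}\lambda^k(1-\lambda)^r$ to $k=0,1,2,\dots$. Let $\Sigma$ map each vector of at most $n$ elements of $\{0,\dots,m-1\}$ to its sum modulo $m$. *Relaxed aggregator.* A randomized map $I$ on vectors of at most $n$ elements of $\{0,\dots,m-1\}$ is an $(\hat\varepsilon,\hat q)$-relaxation of $\Sigma$ if there is a randomized map $\mathrm{SIM}$ with $\mathrm{LLR}(I(\vec y),\mathrm{SIM}(\Sigma(\vec y)))\le\hat\varepsilon$ for all $\vec y$, and a randomized map $\mathrm{POST}$ with $\mathrm{SD}(\mathrm{POST}(I(\vec y)),\Sigma(\vec y))\le\hat q$ for all $\vec y$. *Protocol $P$.* Users $i=1,\dots,n$ hold $x_i\in[0,1]$. Independently, user $i$ draws $\phi_i=\lfloor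 x_ig\rfloor+\mathrm{Ber}(x_ig-\lfloor x_ig\rfloor)$ and independent $\eta_i^+,\eta_i^-\sim\text{Pólya}(2/n,\lambda)$, and sends $y_i=(\phi_i+\eta_i^+-\eta_i^-)\bmod m$. The intermediary, an $(\hat\varepsilon,\hat q)$-relaxation $I$ of $\Sigma$, receives $\vec y=(y_1,\dots,y_n)$ and forwards $I(\vec y)$. The analyzer computes $y=\mathrm{POST}(I(\vec y))\in\{0,\dots,m-1\}$ for some $\mathrm{POST}$ as above, and outputs $P(\vec x)=(y-m)/g$ if $y>ng+2\tau$, and $P(\vec x)=y/g$ otherwise. *Robust privacy.* In an attack $T=(C,W)$, each user $i\in C$ sends a fixed message $w_i\in\{0,\dots,m-1\}$ of the adversary's choice, or nothing, instead of running the above; the other users are honest. The adversary's view is $(C,W,\vec x_C,I(\vec y))$, where $\vec y$ is the vector of the messages sent. $P$ is $\alpha$-robustly differentially private if for every attack with $|C|\le n/2$ and all inputs $\vec x,\vec x'$ that differ only at one index $i\notin C$, the laws of the two views are at $\mathrm{LLR}$ distance at most $\alpha$. **Theorem.** 1. For all $n,m,g\ge1$, $\tau\ge0$, $\varepsilon\in(0,1)$,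 $\hat\varepsilon,\hat q$ and every $(\hat\varepsilon,\hat q)$-relaxation $I$ of $\Sigma$, the protocol $P$ with $\lambda=e^{-\varepsilon/g}$ is $(2\hat\varepsilon+\varepsilon)$-robustly differentially private. 2. There is an absolute constant $K>0$ such that for all $n\ge1$ and $\varepsilon,q\in(0,1)$ there are $g,\tau,m$, depending only on $n,\varepsilon,q$, such that for all $\hat\varepsilon,\hat q$, every $(\hat\varepsilon,\hat q)$-relaxation $I$ of $\Sigma$, every $\mathrm{POST}$ as above and every $\vec x\in[0,1]^n$, the protocol $P$ with $\lambda=e^{-\varepsilon/g}$ and no attack satisfies $$\Pr\left[\left|P(\vec x)-\sum_{i=1}^n x_i\right|\le K\cdot\frac1\varepsilon\ln\frac1q\right]\ge 1-(\hat q+3q).$$ -/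

import Mathlib

open MeasureTheory ProbabilityTheory

namespace SecureSum

noncomputable section

/-! ### Distances between probability distributions -/

/-- Log-likelihood-ratio distance: the supremum over events `E`, not null for both distributions,
of `|ln (μ E / ν E)|`, where a positive number divided by zero is `+∞` and `ln 0 = -∞`
(in absolute value both give `+∞`). -/
def llrDist {α : Type*} [MeasurableSpace α] (μ ν : Measure α) : ENNReal :=
  ⨆ (E : Set α) (_ : MeasurableSet E) (_ : μ E ≠ 0 ∨ ν E ≠ 0), (ENNReal.log (μ E / ν E)).abs

/-- Statistical (total variation) distance of two probability distributions. -/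
def statDist {α : Type*} [MeasurableSpace α] (μ ν : Measure α) : ℝ :=
  ⨆ E : {E : Set α // MeasurableSet E}, |μ.real E - ν.real E|

/-! ### Elementary distributions -/

/-- The joint law of independent random variables with laws `p i`. -/
def independent {ι Y : Type*} [Fintype ι] [DecidableEq ι] [Fintype Y] (p : ι → PMF Y) :
    PMF (ι → Y) :=
  PMF.ofFintype (fun y => ∏ i, p i (y i)) (by
    rw [← Fintype.prod_sum (fun i (y : Y) => p i y)]
    refine Finset.prod_eq_one fun i _ => ?_
    rw [← tsum_fintype (L := SummationFilter.unconditional Y)]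
    exact (p i).tsum_coe)

/-- The Bernoulli distribution `Ber(p)`: `true` with probability `p`. -/
def ber (p : ℝ) (h0 : 0 ≤ p) (h1 : p ≤ 1) : PMF Bool :=
  PMF.ofFintype (fun b => if b then ENNReal.ofReal p else ENNReal.ofReal (1 - p)) (by
    simp only [Fintype.sum_bool, if_true, Bool.false_eq_true, if_false]
    rw [← ENNReal.ofReal_add h0 (by linarith)]
    simp)

/-- Mass that the Pólya distribution `Pólya(r, ρ)` gives to `k`:
`binom(k + r - 1, k) * ρ ^ k * (1 - ρ) ^ r`, with a generalized binomial coefficient. -/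
def polyaMass (r ρ : ℝ) (k : ℕ) : ℝ :=
  Ring.choose (r + k - 1) k * ρ ^ k * (1 - ρ) ^ r

theorem polyaMass_nonneg {r ρ : ℝ} (hr : 0 < r) (hρ : ρ ∈ Set.Ioo (0 : ℝ) 1) (k : ℕ) :
    0 ≤ polyaMass r ρ k := by
  have h1 : 0 ≤ Ring.choose (r + k - 1) k := by
    have h := Ring.factorial_nsmul_multichoose_eq_ascPochhammer r k
    have h2 : Ring.choose (r + k - 1) k = Ring.multichoose r k := by
      unfold Ring.choose
      congr 1
      ring
    rw [h2]
    rw [Polynomial.ascPochhammer_smeval_eq_eval, nsmul_eq_mul] at h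
    have h3 : 0 < (ascPochhammer ℝ k).eval r := ascPochhammer_pos k r hr
    have h4 : (0 : ℝ) < (k.factorial : ℝ) := by positivity
    by_contra hneg
    push Not at hneg
    nlinarith [mul_neg_of_pos_of_neg h4 hneg]
  have h2 : 0 ≤ (1 - ρ) ^ r := Real.rpow_nonneg (by linarith [hρ.2]) r
  have h3 : 0 ≤ ρ ^ k := pow_nonneg hρ.1.le k
  unfold polyaMass
  positivity

theorem polyaMass_hasSum {r ρ : ℝ} (hρ : ρ ∈ Set.Ioo (0 : ℝ) 1) :
    HasSum (polyaMass r ρ) 1 := by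
  have h := (Real.one_div_one_sub_rpow_hasFPowerSeriesOnBall_zero r).hasSum (y := ρ) (by
    rw [← ENNReal.ofReal_one, Metric.eball_ofReal]
    simp [abs_of_pos hρ.1, hρ.2])
  have hpos : 0 < (1 - ρ) ^ r := Real.rpow_pos_of_pos (by linarith [hρ.2]) r
  have h' := h.mul_right ((1 - ρ) ^ r)
  have e : (fun k => (FormalMultilinearSeries.ofScalars ℝ
      (fun k : ℕ => Ring.choose (r + (k : ℝ) - 1) k) k) (fun _ => ρ) * (1 - ρ) ^ r)
      = polyaMass r ρ := by
    funext k
    simp [polyaMass, FormalMultilinearSeries.ofScalars]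
  rw [e] at h'
  simpa only [zero_add, one_div, inv_mul_cancel₀ hpos.ne'] using h'

/-- The Pólya distribution `Pólya(r, ρ)` on the natural numbers. -/
def polya (r ρ : ℝ) (hr : 0 < r) (hρ : ρ ∈ Set.Ioo (0 : ℝ) 1) : PMF ℕ :=
  ⟨fun k => ENNReal.ofReal (polyaMass r ρ k), by
    have h := polyaMass_hasSum (r := r) hρ
    rw [ENNReal.summable.hasSum_iff,
      ← ENNReal.ofReal_tsum_of_nonneg (polyaMass_nonneg hr hρ) h.summable, h.tsum_eq,
      ENNReal.ofReal_one]⟩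

/-! ### The secure intermediary model -/

/-- Vectors of at most `n` messages. -/
abbrev Messages (n : ℕ) (Y : Type*) := {l : List Y // l.length ≤ n}

/-- A protocol with `n` users holding data in `X`, who send messages from the finite set `Y` to
an intermediary; its output, in `Z`, is forwarded to the analyzer, who reports a value in `O`. -/
structure Protocol (n : ℕ) (X Y Z O : Type*) [MeasurableSpace Z] [MeasurableSpace O] where
  /-- the randomizers `R₁, …, Rₙ` -/
  randomizer : Fin n → X → PMF Y
  /-- the (randomized) intermediary -/
  intermediary : Messages n Y → ProbabilityMeasure Z
  /-- the (randomized) analyzer -/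
  analyzer : Kernel Z O
  analyzer_markov : IsMarkovKernel analyzer

/-- An attack: a set of corrupted users and the messages they send (`none` for a user who drops
out). -/
structure Attack (n : ℕ) (Y : Type*) where
  corrupted : Finset (Fin n)
  message : {i // i ∈ corrupted} → Option Y

instance {n : ℕ} {Y : Type*} : MeasurableSpace (Attack n Y) := ⊤

/-- The absence of an attack. -/
def Attack.absent (n : ℕ) (Y : Type*) : Attack n Y where
  corrupted := ∅
  message := fun i => absurd i.2 (Finset.notMem_empty i.1)

/-- What the intermediary receives: the messages that were sent, in the order of the users. -/
def received {n : ℕ} {Y : Type*} (y : Fin n → Option Y) : Messages n Y :=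
  ⟨(List.ofFn y).reduceOption, by
    simpa using List.reduceOption_length_le (List.ofFn y)⟩

namespace Protocol

variable {n : ℕ} {X Y Z O : Type*} [Fintype Y] [MeasurableSpace Z] [MeasurableSpace O]

/-- The law of the message of user `i` under attack `T`. -/
def userLaw (P : Protocol n X Y Z O) (T : Attack n Y) (x : Fin n → X) (i : Fin n) :
    PMF (Option Y) :=
  if h : i ∈ T.corrupted then PMF.pure (T.message ⟨i, h⟩) else (P.randomizer i (x i)).map some

/-- The joint law of all messages under attack `T`; users randomize independently. -/
def messageLaw (P : Protocol n X Y Z O) (T : Attack n Y) (x : Fin n → X) :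
    PMF (Fin n → Option Y) :=
  independent (P.userLaw T x)

/-- The law of the output of the intermediary under attack `T`. -/
def intermediaryLaw (P : Protocol n X Y Z O) (T : Attack n Y) (x : Fin n → X) : Measure Z :=
  ∑ y : Fin n → Option Y, P.messageLaw T x y • (P.intermediary (received y) : Measure Z)

/-- The law of the adversary's view `(C, W, x_C, I(y))`. -/
def viewLaw [MeasurableSpace X] (P : Protocol n X Y Z O) (T : Attack n Y) (x : Fin n → X) :
    Measure (Attack n Y × ({i // i ∈ T.corrupted} → X) × Z) :=
  (P.intermediaryLaw T x).map fun z => (T, fun i => x i.1, z)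

/-- The law of the output `P(x)` of the protocol when there is no attack. -/
def outputLaw (P : Protocol n X Y Z O) (x : Fin n → X) : Measure O :=
  (P.intermediaryLaw (Attack.absent n Y) x).bind P.analyzer

/-- `ε`-robust differential privacy: against any corruption of at most `n / 2` users, the views on
two inputs that differ at most at one honest user are at log-likelihood-ratio distance at most
`ε`. -/
def RobustlyDP [MeasurableSpace X] (P : Protocol n X Y Z O) (ε : ℝ) : Prop :=
  ∀ T : Attack n Y, 2 * T.corrupted.card ≤ n → ∀ i, i ∉ T.corrupted →
    ∀ x x' : Fin n → X, (∀ j, j ≠ i → x j = x' j) →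
      (llrDist (P.viewLaw T x) (P.viewLaw T x') : EReal) ≤ (ε : EReal)

end Protocol

/-! ### Relaxed intermediaries -/

section Relaxation

variable {V Z F : Type*} [MeasurableSpace Z] [MeasurableSpace F]

/-- `I` is `q`-correct with respect to `f`, as witnessed by the (randomized) post-processing
`post`. -/
def CorrectVia (I : V → ProbabilityMeasure Z) (f : V → F) (post : Kernel Z F) (q : ℝ) : Prop :=
  ∀ v, statDist ((I v : Measure Z).bind post) (Measure.dirac (f v)) ≤ q

/-- `I` is `q`-correct with respect to `f`. -/
def IsCorrect (I : V → ProbabilityMeasure Z) (f : V → F) (q : ℝ) : Prop :=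
  ∃ post : Kernel Z F, IsMarkovKernel post ∧ CorrectVia I f post q

/-- `I` is `ε`-log-likelihood-ratio secure with respect to `f`. -/
def IsLLRSecure (I : V → ProbabilityMeasure Z) (f : V → F) (ε : ℝ) : Prop :=
  ∃ sim : Kernel F Z, IsMarkovKernel sim ∧
    ∀ v, (llrDist (I v : Measure Z) (sim (f v)) : EReal) ≤ (ε : EReal)

/-- `I` is an `(ε, q)`-relaxation of `f`. -/
def IsRelaxation (I : V → ProbabilityMeasure Z) (f : V → F) (ε q : ℝ) : Prop :=
  IsLLRSecure I f ε ∧ IsCorrect I f q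

end Relaxation

/-- The aggregator: the sum modulo `m` of at most `n` elements of `{0, …, m - 1}`. -/
def aggregator (m n : ℕ) (l : Messages n (ZMod m)) : ZMod m := l.1.sum

/-! ### The protocol for sums of values in `[0, 1]` -/

/-- Randomized rounding of `x * g`: the law of `⌊x g⌋ + Ber(x g - ⌊x g⌋)`. -/
def rounding (g : ℕ) (x : ℝ) : PMF ℤ :=
  (ber (x * g - ⌊x * g⌋) (Int.fract_nonneg _) (Int.fract_lt_one _).le).map
    fun b => ⌊x * g⌋ + if b then 1 else 0

theorem two_div_pos (n : ℕ) [NeZero n] : 0 < 2 / (n : ℝ) :=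
  div_pos two_pos (Nat.cast_pos.2 (Nat.pos_of_neZero n))

/-- The local randomizer: encode `x` by randomized rounding, add the difference of two independent
`Pólya(2 / n, lam)` samples, reduce modulo `m`. -/
def sumRandomizer (n m g : ℕ) [NeZero n] (lam : Set.Ioo (0 : ℝ) 1) (x : Set.Icc (0 : ℝ) 1) :
    PMF (ZMod m) :=
  (rounding g x).bind fun φ =>
    (polya (2 / n) lam (two_div_pos n) lam.2).bind fun ηp =>
      (polya (2 / n) lam (two_div_pos n) lam.2).bind fun ηm =>
        PMF.pure ((φ + (ηp : ℤ) - (ηm : ℤ) : ℤ) : ZMod m)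

/-- The analyzer function: estimate the sum from a value `y ∈ {0, …, m - 1}`, undoing a
wrap-around. -/
def sumAnalyzer (n m g τ : ℕ) (y : ZMod m) : ℝ :=
  if n * g + 2 * τ < y.val then ((y.val : ℝ) - m) / g else (y.val : ℝ) / g

/-- The symmetric protocol `(R, I, A ∘ post)`, where `post` recovers from the output of the
intermediary the residue modulo `m` that the analyzer function takes as its input. -/
def sumProtocol (n m g τ : ℕ) [NeZero n] [NeZero m] (lam : Set.Ioo (0 : ℝ) 1)
    {Z : Type*} [MeasurableSpace Z] (I : Messages n (ZMod m) → ProbabilityMeasure Z)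
    (post : Kernel Z (ZMod m)) [IsMarkovKernel post] :
    Protocol n (Set.Icc (0 : ℝ) 1) (ZMod m) Z ℝ where
  randomizer := fun _ => sumRandomizer n m g lam
  intermediary := I
  analyzer := post.map (sumAnalyzer n m g τ)
  analyzer_markov := Kernel.IsMarkovKernel.map post (measurable_from_top)

/-- The noise parameter `exp (-ε / g)`, as an element of `(0, 1)`. -/
def noiseParam (ε : ℝ) (hε : 0 < ε) (g : ℕ) [NeZero g] : Set.Ioo (0 : ℝ) 1 :=
  ⟨Real.exp (-ε / g), Real.exp_pos _, Real.exp_lt_one_iff.2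
    (div_neg_of_neg_of_pos (neg_lt_zero.2 hε) (Nat.cast_pos.2 (Nat.pos_of_neZero g)))⟩

end

end SecureSum

open SecureSum

namespace SecureSum

noncomputable section

/-! Laws on a commutative monoid multiply by convolution, and a product of laws is the law of the
independent sum. The intermediary sees the messages essentially through their sum, and reduction
modulo `m` is additive, so both claims reduce to one integer random variable: the sum of the
roundings plus the sum of the noises. Pólya laws are infinitely divisible (`polya_conv`, a
Vandermonde identity), so `k` honest users jointly contribute the difference of two `Pólya(2k/n, λ)`
samples (`polyaNoise_pow`).

Privacy. With at least half of the users honest, the parameter `2k/n` is at least 1. In that range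
each unit shift of the two-sided noise changes its mass by a factor of at most `λ⁻¹`. One user's
rounding moves the sum by at most `g`, at a cost of `λ⁻ᵍ = exp ε`
(`polyaNoise_le_of_natAbs_sub_le`). All other roundings, the corrupted messages and the reduction
modulo `m` are independent of that user or are post-processing (`sumLaw_le`). Passing from the
intermediary to its simulator and back adds `2 * εI` (`intermediaryLaw_le`).

Accuracy. Without an attack the noise is a difference of two `Pólya(2, λ)` samples, with an
exponential tail (`polya_two_tail`). When it stays below `τ`, a modulus above `ng + 3τ` lets the
analyzer undo the wrap-around exactly (`sumAnalyzer_intCast`). What remains is the noise and a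
rounding error of at most 1 per user, both divided by `g`; replacing the exact sum by the output of
the post-processing costs `qI` (`outputLaw_le`). -/

/-! ### Convolution of probability mass functions -/

section Convolution

variable {M N : Type*} [AddCommMonoid M] [AddCommMonoid N]

/-- Convolution makes the probability mass functions on a commutative monoid a commutative
monoid. -/
instance convolutionMonoid : CommMonoid (PMF M) where
  mul p q := p.bind fun a => q.map (a + ·)
  one := PMF.pure 0
  mul_assoc p q r := by
    change (p.bind fun a => q.map (a + ·)).bind (fun a => r.map (a + ·))
      = p.bind fun a => (q.bind fun a => r.map (a + ·)).map (a + ·)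
    simp only [PMF.bind_bind, PMF.bind_map, PMF.map_bind, PMF.map_comp]
    simp only [Function.comp_def, add_assoc]
  one_mul p := by
    change (PMF.pure 0).bind (fun a => p.map (a + ·)) = p
    simp only [PMF.pure_bind, zero_add]
    exact PMF.map_id p
  mul_one p := by
    change p.bind (fun a => (PMF.pure 0).map (a + ·)) = p
    simp [PMF.pure_map]
  mul_comm p q := by
    change p.bind (fun a => q.map (a + ·)) = q.bind (fun a => p.map (a + ·))
    simp only [← PMF.bind_pure_comp, Function.comp_def]
    rw [PMF.bind_comm]
    simp only [add_comm]

theorem conv_def (p q : PMF M) : p * q = p.bind fun a => q.map (a + ·) := rfl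

theorem conv_eq_bind (p q : PMF M) :
    p * q = p.bind fun a => q.bind fun b => PMF.pure (a + b) := rfl

theorem pmf_one_def : (1 : PMF M) = PMF.pure 0 := rfl

theorem map_add_apply {G : Type*} [AddCommGroup G] (p : PMF G) (a b : G) :
    p.map (a + ·) b = p (b - a) := by
  rw [PMF.map_apply, tsum_eq_single (b - a)]
  · simp
  · intro c hc
    rw [if_neg]
    rintro rfl
    exact hc (by simp)

theorem conv_apply {G : Type*} [AddCommGroup G] (p q : PMF G) (b : G) :
    (p * q) b = ∑' a, p a * q (b - a) := by
  simp only [conv_def, PMF.bind_apply, map_add_apply]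

/-- Push-forward along an additive homomorphism respects convolution. -/
def mapHom (f : M →+ N) : PMF M →* PMF N where
  toFun p := p.map f
  map_one' := by simp [pmf_one_def, PMF.pure_map]
  map_mul' p q := by
    simp only [conv_eq_bind, PMF.map_bind, PMF.bind_map, PMF.pure_map, map_add, Function.comp_def]

theorem map_prod_conv {ι : Type*} (f : M →+ N) (s : Finset ι) (p : ι → PMF M) :
    (∏ i ∈ s, p i).map f = ∏ i ∈ s, (p i).map f :=
  map_prod (mapHom f) p s

theorem mem_support_conv {p q : PMF M} {c : M} :
    c ∈ (p * q).support ↔ ∃ a ∈ p.support, ∃ b ∈ q.support, a + b = c := by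
  simp [conv_def]

/-- This permits worst-case bounds on a sum of independent variables: any attainable value splits
into attainable values of the summands. -/
theorem exists_of_mem_support_prod {ι : Type*} [DecidableEq ι] (s : Finset ι) (p : ι → PMF M) {c : M}
    (hc : c ∈ (∏ i ∈ s, p i).support) :
    ∃ a : ι → M, (∀ i ∈ s, a i ∈ (p i).support) ∧ ∑ i ∈ s, a i = c := by
  induction s using Finset.induction_on generalizing c with
  | empty => exact ⟨fun _ => 0, by simp, by simpa [pmf_one_def, eq_comm] using hc⟩
  | insert j s hj ih =>
    rw [Finset.prod_insert hj, mem_support_conv] at hc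
    obtain ⟨b, hb, d, hd, rfl⟩ := hc
    obtain ⟨a, ha, rfl⟩ := ih hd
    have hne : ∀ i ∈ s, i ≠ j := fun i hi h => hj (h ▸ hi)
    refine ⟨Function.update a j b, fun i hi => ?_, ?_⟩
    · rcases Finset.mem_insert.1 hi with rfl | hi
      · simpa using hb
      · simpa [hne i hi] using ha i hi
    · rw [Finset.sum_insert hj, Function.update_self]
      congr 1
      exact Finset.sum_congr rfl fun i hi => by simp [hne i hi]

end Convolution

/-! ### Sums of independent random variables -/

theorem independent_apply {ι Y : Type*} [Fintype ι] [DecidableEq ι] [Fintype Y] (p : ι → PMF Y)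
    (y : ι → Y) : independent p y = ∏ i, p i (y i) := rfl

theorem independent_succ {k : ℕ} {Y : Type*} [Fintype Y] (p : Fin (k + 1) → PMF Y) :
    independent p = (p 0).bind fun a =>
      (independent fun i : Fin k => p i.succ).map (Fin.cons a : _ → Fin (k + 1) → Y) := by
  ext y
  rw [PMF.bind_apply, tsum_eq_single (y 0), PMF.map_apply, tsum_eq_single (Fin.tail y)]
  · rw [if_pos (by simp), independent_apply, independent_apply, Fin.prod_univ_succ]
    rfl
  · intro v hv
    rw [if_neg]
    rintro h
    exact hv (by rw [h, Fin.tail_cons])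
  · intro a ha
    rw [PMF.map_apply, ENNReal.tsum_eq_zero.2, mul_zero]
    intro v
    rw [if_neg]
    rintro h
    exact ha (by rw [h, Fin.cons_zero])

/-- The law of a sum of independent random variables is the convolution of their laws. -/
theorem map_sum_independent {k : ℕ} {Y M : Type*} [Fintype Y] [AddCommMonoid M]
    (p : Fin k → PMF Y) (f : Fin k → Y → M) :
    (independent p).map (fun y => ∑ i, f i (y i)) = ∏ i, (p i).map (f i) := by
  induction k with
  | zero =>
    simp only [Finset.univ_eq_empty, Finset.sum_empty, Finset.prod_empty]
    exact PMF.map_const _ _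
  | succ k ih =>
    rw [independent_succ, Fin.prod_univ_succ, ← ih (fun i => p i.succ) (fun i => f i.succ),
      conv_def, PMF.map_bind, PMF.bind_map]
    congr 1
    funext a
    simp only [PMF.map_comp, Function.comp_def]
    congr 1
    funext v
    simp [Fin.sum_univ_succ]

/-! ### Log-likelihood-ratio distance -/

/-- The product form stays meaningful when a mass vanishes: if exactly one of `a`, `b` is zero, the
logarithm is infinite and one of the two inequalities fails. -/
theorem abs_log_div_le_iff {a b : ENNReal} (ha : a ≠ ⊤) (hb : b ≠ ⊤) (h : a ≠ 0 ∨ b ≠ 0) (α : ℝ) :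
    ((ENNReal.log (a / b)).abs : EReal) ≤ (α : EReal) ↔
      a ≤ ENNReal.ofReal (Real.exp α) * b ∧ b ≤ ENNReal.ofReal (Real.exp α) * a := by
  rcases eq_or_ne a 0 with rfl | ha0
  · have hb0 : b ≠ 0 := by simpa using h
    simp [hb0]
  rcases eq_or_ne b 0 with rfl | hb0
  · simp [ha0, ENNReal.div_zero]
  lift a to NNReal using ha
  lift b to NNReal using hb
  have ha' : (0 : ℝ) < a := by
    have : a ≠ 0 := by simpa using ha0
    exact_mod_cast pos_iff_ne_zero.2 this
  have hb' : (0 : ℝ) < b := by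
    have : b ≠ 0 := by simpa using hb0
    exact_mod_cast pos_iff_ne_zero.2 this
  have hab : (a / b : NNReal) ≠ 0 := by
    rw [← NNReal.coe_ne_zero]
    push_cast
    positivity
  rw [← ENNReal.coe_div (by simpa using hb0), ENNReal.log_of_nnreal hab, EReal.coe_abs,
    EReal.coe_le_coe_iff, NNReal.coe_div, Real.log_div ha'.ne' hb'.ne', abs_le]
  have key : ∀ x y : NNReal, (0 : ℝ) < x → (0 : ℝ) < y →
      ((x : ENNReal) ≤ ENNReal.ofReal (Real.exp α) * y ↔ Real.log x ≤ α + Real.log y) := by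
    intro x y hx hy
    rw [Real.log_le_iff_le_exp hx, Real.exp_add, Real.exp_log hy, ← ENNReal.ofReal_coe_nnreal,
      ← ENNReal.ofReal_coe_nnreal, ← ENNReal.ofReal_mul (Real.exp_pos _).le,
      ENNReal.ofReal_le_ofReal_iff (by positivity)]
  rw [key a b ha' hb', key b a hb' ha']
  constructor <;> rintro ⟨h1, h2⟩ <;> constructor <;> linarith

theorem llrDist_le_iff {α : Type*} [MeasurableSpace α] (μ ν : Measure α) [IsProbabilityMeasure μ]
    [IsProbabilityMeasure ν] (c : ℝ) :
    (llrDist μ ν : EReal) ≤ (c : EReal) ↔ ∀ E, MeasurableSet E →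
      μ E ≤ ENNReal.ofReal (Real.exp c) * ν E ∧ ν E ≤ ENNReal.ofReal (Real.exp c) * μ E := by
  constructor
  · intro h E hE
    by_cases h0 : μ E ≠ 0 ∨ ν E ≠ 0
    · rw [← abs_log_div_le_iff (measure_ne_top _ _) (measure_ne_top _ _) h0]
      refine le_trans (EReal.coe_ennreal_le_coe_ennreal_iff.2 ?_) h
      unfold llrDist
      exact le_iSup₂_of_le E hE (le_iSup_of_le h0 le_rfl)
    · push Not at h0
      simp [h0.1, h0.2]
  · intro h
    have hE : ∀ E, MeasurableSet E → (μ E ≠ 0 ∨ ν E ≠ 0) →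
        ((ENNReal.log (μ E / ν E)).abs : EReal) ≤ (c : EReal) := fun E hE h0 =>
      (abs_log_div_le_iff (measure_ne_top _ _) (measure_ne_top _ _) h0 c).2 (h E hE)
    -- `llrDist` takes values in `ENNReal`, so `c` must be nonnegative to be compared with it. The
    -- non-null event `univ` forces this.
    have hc : 0 ≤ c := by
      have := (EReal.coe_ennreal_nonneg _).trans (hE Set.univ .univ (by simp))
      exact_mod_cast this
    have hc' : ((ENNReal.ofReal c : ENNReal) : EReal) = (c : EReal) := by
      rw [EReal.coe_ennreal_ofReal, max_eq_left hc]
    rw [← hc', EReal.coe_ennreal_le_coe_ennreal_iff]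
    refine iSup₂_le fun E hE' => iSup_le fun h0 => ?_
    rw [← EReal.coe_ennreal_le_coe_ennreal_iff, hc']
    exact hE E hE' h0

/-! ### The Pólya distribution -/

/-- This is the Chu–Vandermonde identity at `-r` and `-s`: up to the sign `(-1) ^ k`, `multichoose r
k` is the generalized binomial `choose (-r) k`. -/
theorem multichoose_add (r s : ℝ) (k : ℕ) :
    Ring.multichoose (r + s) k =
      ∑ ij ∈ Finset.HasAntidiagonal.antidiagonal k, Ring.multichoose r ij.1 * Ring.multichoose s ij.2 := by
  have h := Ring.add_choose_eq k (Commute.all (-r) (-s))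
  have hz : ∀ (i : ℕ) (x : ℝ), Int.negOnePow i • x = (-1) ^ i * x := by
    intro i x
    rw [Units.smul_def, Int.coe_negOnePow_natCast]
    simp
  rw [← neg_add, Ring.choose_neg', hz] at h
  have h2 : ∀ ij ∈ Finset.HasAntidiagonal.antidiagonal k, Ring.choose (-r) ij.1 * Ring.choose (-s) ij.2
      = (-1) ^ k * (Ring.multichoose r ij.1 * Ring.multichoose s ij.2) := by
    intro ij hij
    rw [Ring.choose_neg', Ring.choose_neg', hz, hz, ← Finset.HasAntidiagonal.mem_antidiagonal.1 hij, pow_add]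
    ring
  rw [Finset.sum_congr rfl h2, ← Finset.mul_sum] at h
  exact mul_left_cancel₀ (pow_ne_zero k (by norm_num)) h

theorem polyaMass_eq (r ρ : ℝ) (k : ℕ) :
    polyaMass r ρ k = Ring.multichoose r k * ρ ^ k * (1 - ρ) ^ r := by
  rw [polyaMass, Ring.multichoose_eq]

theorem multichoose_succ_mul (r : ℝ) (k : ℕ) :
    Ring.multichoose r (k + 1) * (k + 1) = Ring.multichoose r k * (r + k) := by
  have h1 := Ring.factorial_nsmul_multichoose_eq_ascPochhammer r (k + 1)
  have h0 := Ring.factorial_nsmul_multichoose_eq_ascPochhammer r k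
  rw [Polynomial.ascPochhammer_smeval_eq_eval, nsmul_eq_mul] at h0 h1
  rw [ascPochhammer_succ_eval, ← h0, Nat.factorial_succ] at h1
  have h4 : (k.factorial : ℝ) ≠ 0 := by positivity
  refine mul_left_cancel₀ h4 ?_
  push_cast at h1
  linear_combination h1

/-- The ratio of consecutive masses is `ρ * (r + k) / (k + 1)`, which is at least `ρ` exactly when
`r ≥ 1`. The honest majority is used to ensure this condition. -/
theorem polyaMass_le_succ {r ρ : ℝ} (hr : 1 ≤ r) (hρ : ρ ∈ Set.Ioo (0 : ℝ) 1) (k : ℕ) :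
    polyaMass r ρ k ≤ ρ⁻¹ * polyaMass r ρ (k + 1) := by
  have h0 := polyaMass_nonneg (by linarith : 0 < r) hρ k
  have h1 := polyaMass_nonneg (by linarith : 0 < r) hρ (k + 1)
  have h := multichoose_succ_mul r k
  have e : polyaMass r ρ (k + 1) * (k + 1) = ρ * polyaMass r ρ k * (r + k) := by
    rw [polyaMass_eq, polyaMass_eq, pow_succ]
    linear_combination ρ ^ k * ρ * (1 - ρ) ^ r * h
  rw [inv_mul_eq_div, le_div_iff₀ hρ.1]
  have hk : (0 : ℝ) < (k : ℝ) + 1 := by positivity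
  refine le_of_mul_le_mul_right ?_ hk
  rw [e]
  have := mul_nonneg hρ.1.le h0
  nlinarith

theorem polya_apply (r ρ : ℝ) (hr : 0 < r) (hρ : ρ ∈ Set.Ioo (0 : ℝ) 1) (k : ℕ) :
    polya r ρ hr hρ k = ENNReal.ofReal (polyaMass r ρ k) := rfl

theorem nat_conv_apply (p q : PMF ℕ) (k : ℕ) :
    (p * q) k = ∑ ij ∈ Finset.HasAntidiagonal.antidiagonal k, p ij.1 * q ij.2 := by
  rw [Finset.Nat.sum_antidiagonal_eq_sum_range_succ (fun i j => p i * q j), conv_def,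
    PMF.bind_apply, tsum_eq_sum (s := Finset.range k.succ)]
  · refine Finset.sum_congr rfl fun a ha => ?_
    have ha' : a ≤ k := Nat.lt_succ_iff.1 (Finset.mem_range.1 ha)
    rw [PMF.map_apply, tsum_eq_single (k - a)]
    · rw [if_pos (by omega)]
    · intro b hb
      rw [if_neg (by omega)]
  · intro a ha
    have ha' : ¬ a < k.succ := fun h => ha (Finset.mem_range.2 h)
    rw [PMF.map_apply, ENNReal.tsum_eq_zero.2, mul_zero]
    intro b
    rw [if_neg (by omega)]

theorem polya_conv {r s ρ : ℝ} (hr : 0 < r) (hs : 0 < s) (hρ : ρ ∈ Set.Ioo (0 : ℝ) 1) :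
    polya r ρ hr hρ * polya s ρ hs hρ = polya (r + s) ρ (add_pos hr hs) hρ := by
  ext k
  have h1 : 0 < 1 - ρ := by linarith [hρ.2]
  simp only [nat_conv_apply, polya_apply]
  rw [polyaMass_eq, multichoose_add, Finset.sum_mul, Finset.sum_mul, ENNReal.ofReal_sum_of_nonneg]
  · refine Finset.sum_congr rfl fun ij hij => ?_
    rw [← ENNReal.ofReal_mul (polyaMass_nonneg hr hρ _), polyaMass_eq, polyaMass_eq,
      Real.rpow_add h1, ← Finset.HasAntidiagonal.mem_antidiagonal.1 hij, pow_add]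
    congr 1
    ring
  · intro ij hij
    have := mul_nonneg (polyaMass_nonneg hr hρ ij.1) (polyaMass_nonneg hs hρ ij.2)
    rw [polyaMass_eq, polyaMass_eq] at this
    rw [Real.rpow_add h1, ← Finset.HasAntidiagonal.mem_antidiagonal.1 hij, pow_add]
    refine this.trans_eq ?_
    ring

theorem polya_pow {r ρ : ℝ} (hr : 0 < r) (hρ : ρ ∈ Set.Ioo (0 : ℝ) 1) (k : ℕ) :
    polya r ρ hr hρ ^ (k + 1) = polya ((k + 1 : ℕ) * r) ρ (by positivity) hρ := by
  induction k with
  | zero => simp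
  | succ k ih =>
    rw [pow_succ, ih, polya_conv]
    congr 1
    push_cast
    ring

/-- Chernoff bound for `Pólya(2, x ^ 2)`. -/
theorem polya_two_tail {x : ℝ} (hx : x ∈ Set.Ioo (0 : ℝ) 1) (hx2 : x ^ 2 ∈ Set.Ioo (0 : ℝ) 1)
    (s : ℕ) :
    (polya 2 (x ^ 2) two_pos hx2).toOuterMeasure {k | s ≤ k} ≤ ENNReal.ofReal (4 * x ^ s) := by
  -- Exponential tilting: since `(1 - x ^ 2) ^ 2 = (1 - x) ^ 2 * (1 + x) ^ 2`, the mass at parameter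
  -- `x ^ 2` is the mass at `x` times `x ^ k * (1 + x) ^ 2`, and `(1 + x) ^ 2 ≤ 4`.
  have key : ∀ k, s ≤ k → polyaMass 2 (x ^ 2) k ≤ 4 * x ^ s * polyaMass 2 x k := by
    intro k hk
    have h0 := polyaMass_nonneg two_pos hx k
    have e : polyaMass 2 (x ^ 2) k = x ^ k * (1 + x) ^ 2 * polyaMass 2 x k := by
      rw [polyaMass_eq, polyaMass_eq, Real.rpow_two, Real.rpow_two]
      ring
    rw [e]
    refine mul_le_mul_of_nonneg_right ?_ h0
    have h1 : x ^ k ≤ x ^ s := pow_le_pow_of_le_one hx.1.le hx.2.le hk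
    have h2 : (1 + x) ^ 2 ≤ 4 := by nlinarith [hx.1, hx.2]
    rw [mul_comm]
    exact mul_le_mul h2 h1 (pow_nonneg hx.1.le _) (by norm_num)
  have h4 : (0 : ℝ) ≤ 4 * x ^ s := by have := hx.1; positivity
  rw [PMF.toOuterMeasure_apply]
  calc ∑' k, Set.indicator {k | s ≤ k} (polya 2 (x ^ 2) two_pos hx2) k
      ≤ ∑' k, ENNReal.ofReal (4 * x ^ s) * polya 2 x two_pos hx k := by
        refine ENNReal.tsum_le_tsum fun k => ?_
        refine Set.indicator_le' (f := ⇑(polya 2 (x ^ 2) two_pos hx2))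
          (g := fun k => ENNReal.ofReal (4 * x ^ s) * polya 2 x two_pos hx k) ?_ ?_ k
        · intro k hk
          rw [polya_apply, polya_apply, ← ENNReal.ofReal_mul h4]
          exact ENNReal.ofReal_le_ofReal (key k hk)
        · intro k _
          exact zero_le
    _ = ENNReal.ofReal (4 * x ^ s) := by
        rw [ENNReal.tsum_mul_left, PMF.tsum_coe, mul_one]

/-! ### Two-sided Pólya noise -/

/-- The law of the difference of two independent `Pólya(r, ρ)` samples. -/
def polyaNoise (r ρ : ℝ) (hr : 0 < r) (hρ : ρ ∈ Set.Ioo (0 : ℝ) 1) : PMF ℤ :=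
  (polya r ρ hr hρ).map (Nat.castAddMonoidHom ℤ) *
    (polya r ρ hr hρ).map (-(Nat.castAddMonoidHom ℤ))

theorem polyaNoise_pow {r ρ : ℝ} (hr : 0 < r) (hρ : ρ ∈ Set.Ioo (0 : ℝ) 1) (k : ℕ) :
    polyaNoise r ρ hr hρ ^ (k + 1) = polyaNoise ((k + 1 : ℕ) * r) ρ (by positivity) hρ := by
  rw [polyaNoise, mul_pow, polyaNoise, ← polya_pow]
  change mapHom _ _ ^ _ * mapHom _ _ ^ _ = mapHom _ _ * mapHom _ _
  rw [map_pow, map_pow]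

theorem map_natCast_apply (p : PMF ℕ) (k : ℕ) : p.map (Nat.castAddMonoidHom ℤ) k = p k := by
  rw [PMF.map_apply, tsum_eq_single k]
  · simp
  · intro b hb
    rw [if_neg]
    simpa using hb.symm

theorem map_natCast_apply_of_neg (p : PMF ℕ) {z : ℤ} (hz : z < 0) :
    p.map (Nat.castAddMonoidHom ℤ) z = 0 := by
  rw [PMF.map_apply, ENNReal.tsum_eq_zero.2]
  intro b
  rw [if_neg]
  rintro rfl
  simp at hz
  omega

theorem map_neg_natCast_apply (p : PMF ℕ) (z : ℤ) :
    p.map (-(Nat.castAddMonoidHom ℤ)) z = p.map (Nat.castAddMonoidHom ℤ) (-z) := by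
  rw [PMF.map_apply, PMF.map_apply]
  refine tsum_congr fun a => ?_
  have e : z = (-(Nat.castAddMonoidHom ℤ)) a ↔ -z = Nat.castAddMonoidHom ℤ a := by
    rw [AddMonoidHom.neg_apply, neg_eq_iff_eq_neg]
  by_cases h : z = (-(Nat.castAddMonoidHom ℤ)) a
  · rw [if_pos h, if_pos (e.1 h)]
  · rw [if_neg h, if_neg (mt e.2 h)]

theorem map_natCast_polya_le_succ {r ρ : ℝ} (hr : 1 ≤ r) (hρ : ρ ∈ Set.Ioo (0 : ℝ) 1)
    (hr0 : 0 < r) (z : ℤ) :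
    (polya r ρ hr0 hρ).map (Nat.castAddMonoidHom ℤ) z ≤
      ENNReal.ofReal ρ⁻¹ * (polya r ρ hr0 hρ).map (Nat.castAddMonoidHom ℤ) (z + 1) := by
  rcases lt_or_ge z 0 with hz | hz
  · rw [map_natCast_apply_of_neg _ hz]
    exact zero_le
  · lift z to ℕ using hz
    have := map_natCast_apply (polya r ρ hr0 hρ) (z + 1)
    push_cast at this
    rw [map_natCast_apply, this, polya_apply, polya_apply,
      ← ENNReal.ofReal_mul (inv_nonneg.2 hρ.1.le)]
    exact ENNReal.ofReal_le_ofReal (polyaMass_le_succ hr hρ z)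

/-- A single Pólya law is controlled only upwards, because its mass jumps from zero at the origin.
Here the upward step is taken by the positive part, with the negative part held fixed; in
`polyaNoise_succ_le` the negative part takes it, which handles the other direction. -/
theorem polyaNoise_le_succ {r ρ : ℝ} (hr : 1 ≤ r) (hρ : ρ ∈ Set.Ioo (0 : ℝ) 1)
    (hr0 : 0 < r) (z : ℤ) :
    polyaNoise r ρ hr0 hρ z ≤ ENNReal.ofReal ρ⁻¹ * polyaNoise r ρ hr0 hρ (z + 1) := by
  rw [polyaNoise, mul_comm, conv_apply, conv_apply, ← ENNReal.tsum_mul_left]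
  refine ENNReal.tsum_le_tsum fun a => ?_
  rw [mul_left_comm, add_sub_right_comm]
  gcongr
  exact map_natCast_polya_le_succ hr hρ hr0 _

theorem polyaNoise_succ_le {r ρ : ℝ} (hr : 1 ≤ r) (hρ : ρ ∈ Set.Ioo (0 : ℝ) 1)
    (hr0 : 0 < r) (z : ℤ) :
    polyaNoise r ρ hr0 hρ (z + 1) ≤ ENNReal.ofReal ρ⁻¹ * polyaNoise r ρ hr0 hρ z := by
  rw [polyaNoise, conv_apply, conv_apply, ← ENNReal.tsum_mul_left]
  refine ENNReal.tsum_le_tsum fun a => ?_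
  rw [mul_left_comm, map_neg_natCast_apply, map_neg_natCast_apply]
  gcongr
  have e : -(z - a) = -(z + 1 - a) + 1 := by ring
  rw [e]
  exact map_natCast_polya_le_succ hr hρ hr0 _

theorem le_pow_natAbs_mul {f : ℤ → ENNReal} {C : ENNReal} (h1 : ∀ z, f z ≤ C * f (z + 1))
    (h2 : ∀ z, f (z + 1) ≤ C * f z) (a b : ℤ) : f a ≤ C ^ (a - b).natAbs * f b := by
  have up : ∀ (k : ℕ) (z : ℤ), f z ≤ C ^ k * f (z + k) := by
    intro k
    induction k with
    | zero => simp
    | succ k ih =>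
      intro z
      refine (ih z).trans ?_
      rw [pow_succ, mul_assoc]
      gcongr
      rw [Nat.cast_succ, ← add_assoc]
      exact h1 _
  have down : ∀ (k : ℕ) (z : ℤ), f (z + k) ≤ C ^ k * f z := by
    intro k
    induction k with
    | zero => simp
    | succ k ih =>
      intro z
      rw [pow_succ', mul_assoc]
      refine le_trans ?_ (mul_le_mul_right (ih z) C)
      rw [Nat.cast_succ, ← add_assoc]
      exact h2 _
  rcases le_total a b with h | h
  · convert up (a - b).natAbs a using 3
    omega
  · convert down (a - b).natAbs b using 2
    omega

/-- Integer shifts by at most `g` change the likelihood of Pólya noise by a factor of at most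
`exp ε`. -/
theorem polyaNoise_le_of_natAbs_sub_le {r ε : ℝ} {g : ℕ} [NeZero g] (hr : 1 ≤ r) (hε : 0 < ε)
    (hr0 : 0 < r) {a b : ℤ} (h : (a - b).natAbs ≤ g) :
    polyaNoise r (noiseParam ε hε g) hr0 (noiseParam ε hε g).2 a ≤
      ENNReal.ofReal (Real.exp ε) *
        polyaNoise r (noiseParam ε hε g) hr0 (noiseParam ε hε g).2 b := by
  set ρ := noiseParam ε hε g with hρ
  refine (le_pow_natAbs_mul (C := ENNReal.ofReal (ρ : ℝ)⁻¹) (polyaNoise_le_succ hr ρ.2 hr0)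
    (polyaNoise_succ_le hr ρ.2 hr0) a b).trans ?_
  gcongr
  have hg : (0 : ℝ) < g := Nat.cast_pos.2 (Nat.pos_of_neZero g)
  have h1 : (ρ : ℝ)⁻¹ = Real.exp (ε / g) := by
    rw [hρ, noiseParam, ← Real.exp_neg, neg_div, neg_neg]
  rw [h1, ← ENNReal.ofReal_pow (Real.exp_pos _).le, ← Real.exp_nat_mul]
  refine ENNReal.ofReal_le_ofReal (Real.exp_le_exp.2 ?_)
  rw [mul_div_left_comm]
  refine mul_le_of_le_one_right hε.le ?_
  rw [div_le_one hg]
  exact_mod_cast h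

/-! ### Randomized rounding -/

theorem mem_support_rounding {g : ℕ} {x : ℝ} {φ : ℤ} (h : φ ∈ (rounding g x).support) :
    ⌊x * g⌋ ≤ φ ∧ φ ≤ ⌈x * g⌉ := by
  rw [rounding, PMF.mem_support_map_iff] at h
  obtain ⟨b, hb, rfl⟩ := h
  cases b with
  | false => simpa using Int.floor_le_ceil _
  | true =>
    refine ⟨by simp, ?_⟩
    -- If `x * g` is an integer, the Bernoulli parameter is zero and `true` lies outside the
    -- support; otherwise the floor plus one is the ceiling.
    have : ⌊x * g⌋ < x * g := by
      have : 0 < Int.fract (x * g) := by simpa [ber, PMF.support_ofFintype] using hb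
      rwa [Int.fract, sub_pos] at this
    have := Int.lt_ceil.2 this
    simpa using this

theorem mem_support_rounding_Icc {g : ℕ} {x : ℝ} (hx : x ∈ Set.Icc (0 : ℝ) 1) {φ : ℤ}
    (h : φ ∈ (rounding g x).support) : 0 ≤ φ ∧ φ ≤ g := by
  obtain ⟨h1, h2⟩ := mem_support_rounding h
  refine ⟨le_trans (Int.floor_nonneg.2 (mul_nonneg hx.1 (Nat.cast_nonneg _))) h1, h2.trans ?_⟩
  rw [Int.ceil_le]
  simpa using mul_le_of_le_one_left (Nat.cast_nonneg g) hx.2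

theorem abs_sub_le_of_mem_support_rounding {g : ℕ} {x : ℝ} {φ : ℤ}
    (h : φ ∈ (rounding g x).support) : |(φ : ℝ) - x * g| ≤ 1 := by
  obtain ⟨h1, h2⟩ := mem_support_rounding h
  have h1' : (⌊x * g⌋ : ℝ) ≤ φ := by exact_mod_cast h1
  have h2' : (φ : ℝ) ≤ ⌈x * g⌉ := by exact_mod_cast h2
  have := Int.ceil_lt_add_one (x * g)
  have := Int.sub_one_lt_floor (x * g)
  rw [abs_le]
  constructor <;> linarith

/-- Reduction modulo `m` is an additive homomorphism, so it can be postponed until all messages have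
been added in `ℤ`. -/
theorem sumRandomizer_eq (n m g : ℕ) [NeZero n] (lam : Set.Ioo (0 : ℝ) 1)
    (x : Set.Icc (0 : ℝ) 1) :
    sumRandomizer n m g lam x =
      (rounding g x * polyaNoise (2 / n) lam (two_div_pos n) lam.2).map
        (Int.castAddHom (ZMod m)) := by
  simp only [sumRandomizer, polyaNoise, conv_eq_bind, PMF.map_bind, PMF.bind_bind, PMF.bind_map,
    PMF.pure_map, PMF.pure_bind, Function.comp_def]
  simp [sub_eq_add_neg, add_assoc]

/-! ### Pointwise domination of probability mass functions -/

/-- Average the inequality over `a'` and then over `a`. As it holds for every pair of attainable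
values, the laws `p` and `p'` need not be comparable; they will be the roundings of two different
inputs. -/
theorem bind_apply_le_of_forall {α β : Type*} {c : ENNReal} (p p' : PMF α) (f f' : α → PMF β) (b : β)
    (h : ∀ a ∈ p.support, ∀ a' ∈ p'.support, f a b ≤ c * f' a' b) :
    p.bind f b ≤ c * p'.bind f' b := by
  have h1 : ∀ a ∈ p.support, f a b ≤ c * p'.bind f' b := by
    intro a ha
    calc f a b = ∑' a', p' a' * f a b := by rw [ENNReal.tsum_mul_right, p'.tsum_coe, one_mul]
      _ ≤ ∑' a', c * (p' a' * f' a' b) := by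
        refine ENNReal.tsum_le_tsum fun a' => ?_
        by_cases ha' : a' ∈ p'.support
        · rw [mul_left_comm]
          gcongr
          exact h a ha a' ha'
        · rw [(p'.apply_eq_zero_iff a').2 ha', zero_mul]
          exact zero_le
      _ = c * p'.bind f' b := by rw [ENNReal.tsum_mul_left, PMF.bind_apply]
  calc p.bind f b = ∑' a, p a * f a b := PMF.bind_apply ..
    _ ≤ ∑' a, p a * (c * p'.bind f' b) := by
      refine ENNReal.tsum_le_tsum fun a => ?_
      by_cases ha : a ∈ p.support
      · gcongr
        exact h1 a ha
      · rw [(p.apply_eq_zero_iff a).2 ha, zero_mul, zero_mul]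
    _ = c * p'.bind f' b := by rw [ENNReal.tsum_mul_right, p.tsum_coe, one_mul]

theorem bind_apply_le {α β : Type*} {c : ENNReal} {p p' : PMF α} (h : ∀ a, p a ≤ c * p' a)
    (f : α → PMF β) (b : β) : p.bind f b ≤ c * p'.bind f b := by
  rw [PMF.bind_apply, PMF.bind_apply, ← ENNReal.tsum_mul_left]
  refine ENNReal.tsum_le_tsum fun a => ?_
  rw [← mul_assoc]
  gcongr
  exact h a

theorem conv_apply_le {M : Type*} [AddCommMonoid M] {c : ENNReal} {p p' : PMF M}
    (h : ∀ a, p a ≤ c * p' a) (q : PMF M) (b : M) : (p * q) b ≤ c * (p' * q) b :=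
  bind_apply_le h _ b

/-! ### The law of the sum of the messages -/

/-- The sum of the messages that were sent. -/
theorem aggregator_received {m n : ℕ} (y : Fin n → Option (ZMod m)) :
    aggregator m n (received y) = ∑ i, (y i).getD 0 := by
  have h : ∀ l : List (Option (ZMod m)), l.reduceOption.sum = (l.map (·.getD 0)).sum := by
    intro l
    induction l with
    | nil => rfl
    | cons a l ih => cases a <;> simp [ih]
  rw [aggregator, received, h, List.map_ofFn, List.sum_ofFn]
  rfl

/-- The law of the sum of the messages under attack `T`. -/
def sumLaw {n m : ℕ} [NeZero m] {X Z O : Type*} [MeasurableSpace Z] [MeasurableSpace O]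
    (P : Protocol n X (ZMod m) Z O) (T : Attack n (ZMod m)) (x : Fin n → X) : PMF (ZMod m) :=
  (P.messageLaw T x).map fun y => aggregator m n (received y)

theorem sumLaw_eq_prod {n m : ℕ} [NeZero m] {X Z O : Type*} [MeasurableSpace Z]
    [MeasurableSpace O] (P : Protocol n X (ZMod m) Z O) (T : Attack n (ZMod m)) (x : Fin n → X) :
    sumLaw P T x = ∏ i, (P.userLaw T x i).map (·.getD 0) := by
  simp only [sumLaw, aggregator_received]
  exact map_sum_independent (P.userLaw T x) fun _ y => y.getD 0

section

variable {n m g τ : ℕ} [NeZero n] [NeZero m] {lam : Set.Ioo (0 : ℝ) 1}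
  {Z : Type*} [MeasurableSpace Z] {I : Messages n (ZMod m) → ProbabilityMeasure Z}
  {post : Kernel Z (ZMod m)} [IsMarkovKernel post]

theorem map_userLaw_of_notMem {T : Attack n (ZMod m)} {i : Fin n} (hi : i ∉ T.corrupted)
    (x : Fin n → Set.Icc (0 : ℝ) 1) :
    ((sumProtocol n m g τ lam I post).userLaw T x i).map (·.getD 0) =
      (rounding g (x i) * polyaNoise (2 / n) lam (two_div_pos n) lam.2).map
        (Int.castAddHom (ZMod m)) := by
  rw [← sumRandomizer_eq, Protocol.userLaw, dif_neg hi, PMF.map_comp]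
  exact PMF.map_id _

theorem prod_map_userLaw_honest (T : Attack n (ZMod m)) (x : Fin n → Set.Icc (0 : ℝ) 1) :
    ∏ i ∈ T.corruptedᶜ, ((sumProtocol n m g τ lam I post).userLaw T x i).map (·.getD 0) =
      ((∏ i ∈ T.corruptedᶜ, rounding g (x i)) *
        polyaNoise (2 / n) lam (two_div_pos n) lam.2 ^ T.corruptedᶜ.card).map
          (Int.castAddHom (ZMod m)) := by
  rw [← Finset.prod_const, ← Finset.prod_mul_distrib, map_prod_conv]
  exact Finset.prod_congr rfl fun i hi => map_userLaw_of_notMem (Finset.mem_compl.1 hi) x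

/-- The law of the sum of the messages changes by a factor of at most `exp ε` when the input of
one honest user does. -/
theorem sumLaw_le {ε : ℝ} (hε : 0 < ε) [NeZero g] {T : Attack n (ZMod m)}
    (hT : 2 * T.corrupted.card ≤ n) {i : Fin n} (hi : i ∉ T.corrupted)
    {x x' : Fin n → Set.Icc (0 : ℝ) 1} (hx : ∀ j, j ≠ i → x j = x' j) (s : ZMod m) :
    sumLaw (sumProtocol n m g τ (noiseParam ε hε g) I post) T x s ≤
      ENNReal.ofReal (Real.exp ε) *
        sumLaw (sumProtocol n m g τ (noiseParam ε hε g) I post) T x' s := by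
  have hi' : i ∈ T.corruptedᶜ := Finset.mem_compl.2 hi
  have hn : (0 : ℝ) < n := Nat.cast_pos.2 (Nat.pos_of_neZero n)
  obtain ⟨k, hk⟩ : ∃ k, T.corruptedᶜ.card = k + 1 :=
    Nat.exists_eq_succ_of_ne_zero (Finset.card_ne_zero_of_mem hi')
  have hk1 : n ≤ (k + 1) * 2 := by
    have := Finset.card_compl T.corrupted
    rw [Fintype.card_fin] at this
    omega
  -- At least `n / 2` honest users, each with parameter `2 / n`, give a total Pólya parameter of at
  -- least 1.
  have hr : (1 : ℝ) ≤ ((k + 1 : ℕ) : ℝ) * (2 / n) := by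
    rw [← mul_div_assoc, le_div_iff₀ hn, one_mul]
    exact_mod_cast hk1
  rw [sumLaw_eq_prod, sumLaw_eq_prod, ← Finset.prod_compl_mul_prod T.corrupted,
    ← Finset.prod_compl_mul_prod (M := PMF (ZMod m)) T.corrupted, prod_map_userLaw_honest,
    prod_map_userLaw_honest, hk, polyaNoise_pow,
    ← Finset.mul_prod_erase _ _ hi', ← Finset.mul_prod_erase _ (fun j => rounding g (x' j)) hi']
  have hC : ∏ j ∈ T.corrupted, ((sumProtocol n m g τ (noiseParam ε hε g) I post).userLaw T x j).map
      (·.getD 0) = ∏ j ∈ T.corrupted,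
        ((sumProtocol n m g τ (noiseParam ε hε g) I post).userLaw T x' j).map (·.getD 0) :=
    Finset.prod_congr rfl fun j hj => by
      rw [Protocol.userLaw, Protocol.userLaw, dif_pos hj, dif_pos hj]
  have hR : ∏ j ∈ T.corruptedᶜ.erase i, rounding g (x j) =
      ∏ j ∈ T.corruptedᶜ.erase i, rounding g (x' j) :=
    Finset.prod_congr rfl fun j hj => by rw [hx j (Finset.ne_of_mem_erase hj)]
  rw [hC, hR]
  -- The corrupted messages are a common convolution factor and the reduction modulo `m` is a common
  -- map, so both can be stripped. Regrouping then does the same for the roundings of the other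
  -- honest users.
  refine conv_apply_le (fun a => bind_apply_le (fun z => ?_) _ a) _ s
  rw [mul_right_comm, mul_right_comm (rounding g (x' i))]
  refine conv_apply_le (fun z => ?_) _ z
  -- Only user `i`'s rounding and the joint noise remain. Both roundings lie in `[0, g]`, so the
  -- noise is evaluated at points at most `g` apart.
  refine bind_apply_le_of_forall _ _ _ _ _ fun φ hφ φ' hφ' => ?_
  rw [map_add_apply, map_add_apply]
  refine polyaNoise_le_of_natAbs_sub_le hr hε _ ?_
  have h1 := mem_support_rounding_Icc (x i).2 hφ
  have h2 := mem_support_rounding_Icc (x' i).2 hφ'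
  omega

end

/-! ### Privacy of the view -/

theorem sum_messageLaw_mul {n m : ℕ} [NeZero m] {X Z O : Type*} [MeasurableSpace Z]
    [MeasurableSpace O] (P : Protocol n X (ZMod m) Z O) (T : Attack n (ZMod m)) (x : Fin n → X)
    (f : ZMod m → ENNReal) :
    ∑ y, P.messageLaw T x y * f (aggregator m n (received y)) = ∑ s, sumLaw P T x s * f s := by
  have h : ∀ s, sumLaw P T x s * f s = ∑ y, P.messageLaw T x y *
      if s = aggregator m n (received y) then f s else 0 := by
    intro s
    rw [sumLaw, PMF.map_apply, tsum_fintype, Finset.sum_mul]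
    refine Finset.sum_congr rfl fun y _ => ?_
    split_ifs <;> simp
  simp only [h]
  rw [Finset.sum_comm]
  refine Finset.sum_congr rfl fun y _ => ?_
  rw [← Finset.mul_sum, Finset.sum_ite_eq' Finset.univ]
  simp

theorem intermediaryLaw_apply {n m : ℕ} [NeZero m] {X Z O : Type*} [MeasurableSpace Z]
    [MeasurableSpace O] (P : Protocol n X (ZMod m) Z O) (T : Attack n (ZMod m)) (x : Fin n → X)
    (E : Set Z) :
    P.intermediaryLaw T x E =
      ∑ y, P.messageLaw T x y * (P.intermediary (received y) : Measure Z) E := by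
  simp [Protocol.intermediaryLaw, Measure.finsetSum_apply]

instance {n m : ℕ} [NeZero m] {X Z O : Type*} [MeasurableSpace Z]
    [MeasurableSpace O] (P : Protocol n X (ZMod m) Z O) (T : Attack n (ZMod m)) (x : Fin n → X) :
    IsProbabilityMeasure (P.intermediaryLaw T x) := by
  constructor
  rw [intermediaryLaw_apply]
  simp only [measure_univ, mul_one]
  rw [← tsum_fintype (L := SummationFilter.unconditional _)]
  exact PMF.tsum_coe _

/-- The simulator sees only the sum, so between the two exchanges of intermediary and simulator,
each costing `exp εI`, only the laws of the sum have to be compared. -/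
theorem intermediaryLaw_le {n m : ℕ} [NeZero m] {X Z O : Type*} [MeasurableSpace Z]
    [MeasurableSpace O] (P : Protocol n X (ZMod m) Z O) (T : Attack n (ZMod m))
    {x x' : Fin n → X} {sim : Kernel (ZMod m) Z} {εI ε : ℝ} {E : Set Z}
    (h1 : ∀ v, (P.intermediary v : Measure Z) E ≤
      ENNReal.ofReal (Real.exp εI) * sim (aggregator m n v) E)
    (h2 : ∀ v, sim (aggregator m n v) E ≤
      ENNReal.ofReal (Real.exp εI) * (P.intermediary v : Measure Z) E)
    (h : ∀ s, sumLaw P T x s ≤ ENNReal.ofReal (Real.exp ε) * sumLaw P T x' s) :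
    P.intermediaryLaw T x E ≤
      ENNReal.ofReal (Real.exp (2 * εI + ε)) * P.intermediaryLaw T x' E := by
  have e : ENNReal.ofReal (Real.exp (2 * εI + ε)) = ENNReal.ofReal (Real.exp εI) *
      (ENNReal.ofReal (Real.exp ε) * ENNReal.ofReal (Real.exp εI)) := by
    rw [← ENNReal.ofReal_mul (Real.exp_pos _).le, ← ENNReal.ofReal_mul (Real.exp_pos _).le,
      ← Real.exp_add, ← Real.exp_add]
    congr 2
    ring
  rw [intermediaryLaw_apply, intermediaryLaw_apply, e]
  calc ∑ y, P.messageLaw T x y * (P.intermediary (received y) : Measure Z) E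
      ≤ ∑ y, ENNReal.ofReal (Real.exp εI) *
          (P.messageLaw T x y * sim (aggregator m n (received y)) E) := by
        refine Finset.sum_le_sum fun y _ => ?_
        rw [mul_left_comm]
        gcongr
        exact h1 _
    _ = ENNReal.ofReal (Real.exp εI) * ∑ s, sumLaw P T x s * sim s E := by
        rw [← Finset.mul_sum, sum_messageLaw_mul P T x fun s => sim s E]
    _ ≤ ENNReal.ofReal (Real.exp εI) *
          ∑ s, ENNReal.ofReal (Real.exp ε) * (sumLaw P T x' s * sim s E) := by
        refine mul_le_mul_right (Finset.sum_le_sum fun s _ => ?_) _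
        rw [← mul_assoc]
        gcongr
        exact h s
    _ = ENNReal.ofReal (Real.exp εI) * (ENNReal.ofReal (Real.exp ε) *
          ∑ y, P.messageLaw T x' y * sim (aggregator m n (received y)) E) := by
        rw [← Finset.mul_sum, sum_messageLaw_mul P T x' fun s => sim s E]
    _ ≤ ENNReal.ofReal (Real.exp εI) * (ENNReal.ofReal (Real.exp ε) *
          ∑ y, ENNReal.ofReal (Real.exp εI) *
            (P.messageLaw T x' y * (P.intermediary (received y) : Measure Z) E)) := by
        refine mul_le_mul_right (mul_le_mul_right (Finset.sum_le_sum fun y _ => ?_) _) _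
        rw [mul_left_comm]
        gcongr
        exact h2 _
    _ = _ := by rw [← Finset.mul_sum, mul_assoc, mul_assoc]

theorem robustlyDP_sumProtocol {n m g τ : ℕ} [NeZero n] [NeZero m] [NeZero g] {ε : ℝ} (hε : 0 < ε)
    {εI : ℝ} {Z : Type*} [MeasurableSpace Z] {I : Messages n (ZMod m) → ProbabilityMeasure Z}
    (post : Kernel Z (ZMod m)) [IsMarkovKernel post]
    (hI : IsLLRSecure I (aggregator m n) εI) :
    (sumProtocol n m g τ (noiseParam ε hε g) I post).RobustlyDP (2 * εI + ε) := by
  intro T hT i hi x x' hx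
  obtain ⟨sim, hsim, hI⟩ := hI
  set P := sumProtocol n m g τ (noiseParam ε hε g) I post with hP
  have hmeas : ∀ c : {i // i ∈ T.corrupted} → Set.Icc (0 : ℝ) 1,
      Measurable fun z : Z => (T, c, z) := fun c =>
    measurable_const.prodMk (measurable_const.prodMk measurable_id)
  -- The inputs differ only at an honest user, so both views are images of the intermediary's output
  -- under the same map, and events pull back to events about that output.
  have hc : (fun j : {i // i ∈ T.corrupted} => x j.1) = fun j => x' j.1 := by
    funext j
    exact hx j.1 fun h => hi (h ▸ j.2)
  have hI' := fun v => (llrDist_le_iff _ _ εI).1 (hI v)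
  have := Measure.isProbabilityMeasure_map (μ := P.intermediaryLaw T x)
    (hmeas fun j => x j.1).aemeasurable
  have := Measure.isProbabilityMeasure_map (μ := P.intermediaryLaw T x')
    (hmeas fun j => x' j.1).aemeasurable
  unfold Protocol.viewLaw
  rw [llrDist_le_iff]
  intro E hE
  rw [Measure.map_apply (hmeas _) hE, Measure.map_apply (hmeas _) hE, hc]
  have hE' := hmeas (fun j => x' j.1) hE
  exact ⟨intermediaryLaw_le P T (fun v => (hI' v _ hE').1) (fun v => (hI' v _ hE').2)
      (sumLaw_le hε hT hi hx),
    intermediaryLaw_le P T (fun v => (hI' v _ hE').1) (fun v => (hI' v _ hE').2)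
      (sumLaw_le hε hT hi fun j hj => (hx j hj).symm)⟩

/-! ### Concentration of the noise -/

/-- A union bound over the two stages: either the first stage lands in the bad set `B`, or the
second stage fails with probability at most `δ`. -/
theorem toOuterMeasure_bind_le {α β : Type*} (p : PMF α) (f : α → PMF β) (B : Set α) (E : Set β)
    (δ : ENNReal) (h : ∀ a ∈ p.support, a ∉ B → (f a).toOuterMeasure E ≤ δ) :
    (p.bind f).toOuterMeasure E ≤ p.toOuterMeasure B + δ := by
  have h1 : ∀ (q : PMF β), q.toOuterMeasure E ≤ 1 := fun q => by
    rw [PMF.toOuterMeasure_apply, ← q.tsum_coe]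
    exact ENNReal.tsum_le_tsum fun b => Set.indicator_le_self _ _ b
  rw [PMF.toOuterMeasure_bind_apply, PMF.toOuterMeasure_apply]
  calc ∑' a, p a * (f a).toOuterMeasure E ≤ ∑' a, (B.indicator p a + p a * δ) := by
        refine ENNReal.tsum_le_tsum fun a => ?_
        by_cases ha : a ∈ B
        · rw [Set.indicator_of_mem ha]
          exact (mul_le_of_le_one_right' (h1 _)).trans le_self_add
        · by_cases ha' : a ∈ p.support
          · refine le_trans ?_ le_add_self
            gcongr
            exact h a ha' ha
          · rw [(p.apply_eq_zero_iff a).2 ha', zero_mul]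
            exact zero_le
    _ = _ := by rw [ENNReal.tsum_add, ENNReal.tsum_mul_right, p.tsum_coe, one_mul]

/-- Two natural numbers below `s` differ by less than `s`, so a large difference forces one of the
two samples into its tail; this gives the factor 2. -/
theorem polyaNoise_tail {x : ℝ} (hx : x ∈ Set.Ioo (0 : ℝ) 1) (hx2 : x ^ 2 ∈ Set.Ioo (0 : ℝ) 1)
    (s : ℕ) :
    (polyaNoise 2 (x ^ 2) two_pos hx2).toOuterMeasure {z | s ≤ z.natAbs} ≤
      2 * ENNReal.ofReal (4 * x ^ s) := by
  have ht := polya_two_tail hx hx2 s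
  rw [polyaNoise, conv_def, PMF.bind_map, two_mul]
  refine (toOuterMeasure_bind_le _ _ {k | s ≤ k} _ (ENNReal.ofReal (4 * x ^ s))
    fun a _ ha => ?_).trans (by gcongr)
  rw [Function.comp_apply, PMF.map_comp, PMF.toOuterMeasure_map_apply]
  refine le_trans (measure_mono fun b hb => ?_) ht
  simp only [Set.mem_ofPred_eq, Set.mem_preimage, Function.comp_apply, Nat.coe_castAddMonoidHom,
    AddMonoidHom.neg_apply, not_le] at *
  omega

theorem polyaNoise_pow_of_mul_eq {r s ρ : ℝ} (hr : 0 < r) (hs : 0 < s)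
    (hρ : ρ ∈ Set.Ioo (0 : ℝ) 1) {k : ℕ} (hk : k ≠ 0) (h : k * r = s) :
    polyaNoise r ρ hr hρ ^ k = polyaNoise s ρ hs hρ := by
  subst h
  obtain ⟨k, rfl⟩ := Nat.exists_eq_succ_of_ne_zero hk
  exact polyaNoise_pow hr hρ k

/-! ### Accuracy -/

theorem sumAnalyzer_intCast {n g τ m : ℕ} (hm : n * g + 3 * τ < m) {S z : ℤ} (hS0 : 0 ≤ S)
    (hS : S ≤ n * g) (hz : z.natAbs ≤ τ) :
    sumAnalyzer n m g τ ((S + z : ℤ) : ZMod m) = ((S + z : ℤ) : ℝ) / g := by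
  have : NeZero m := ⟨by omega⟩
  have hS' : S ≤ ((n * g : ℕ) : ℤ) := by exact_mod_cast hS
  have hval : ∀ k : ℕ, k < m → (((k : ℤ) : ZMod m)).val = k := fun k hk => by
    rw [Int.cast_natCast, ZMod.val_natCast_of_lt hk]
  rw [sumAnalyzer]
  -- A nonnegative value is at most `n * g + τ` and is its own residue. A negative one is at least
  -- `-τ`, so its residue is at least `m - τ > n * g + 2 * τ`. The analyzer's threshold separates
  -- the two cases.
  rcases le_or_gt 0 (S + z) with h | h
  · obtain ⟨k, hk⟩ := Int.eq_ofNat_of_zero_le h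
    rw [hk, hval k (by omega), if_neg (by omega)]
    simp
  · obtain ⟨k, hk⟩ := Int.eq_ofNat_of_zero_le (show 0 ≤ S + z + m by omega)
    have e : ((S + z : ℤ) : ZMod m) = ((k : ℤ) : ZMod m) := by
      rw [← hk]
      push_cast
      simp
    rw [e, hval k (by omega), if_pos (by omega)]
    congr 1
    have : ((k : ℤ) : ℝ) = ((S + z + m : ℤ) : ℝ) := by rw [← hk]
    push_cast at this ⊢
    linarith

theorem abs_measureReal_sub_le_statDist {α : Type*} [MeasurableSpace α] (μ ν : Measure α)
    [IsProbabilityMeasure μ] [IsProbabilityMeasure ν] {E : Set α} (hE : MeasurableSet E) :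
    |μ.real E - ν.real E| ≤ statDist μ ν := by
  -- A real supremum bounds its members only for families that are bounded above; here the bound is
  -- 1.
  refine le_ciSup (f := fun E : {E : Set α // MeasurableSet E} => |μ.real E - ν.real E|)
    ⟨1, ?_⟩ ⟨E, hE⟩
  rintro _ ⟨F, rfl⟩
  have h1 := measureReal_le_one (μ := μ) (s := (F : Set α))
  have h2 := measureReal_le_one (μ := ν) (s := (F : Set α))
  have h3 := measureReal_nonneg (μ := μ) (s := (F : Set α))
  have h4 := measureReal_nonneg (μ := ν) (s := (F : Set α))
  rw [abs_le]
  constructor <;> linarith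

theorem CorrectVia.nonneg {V Z F : Type*} [MeasurableSpace Z] [MeasurableSpace F]
    {I : V → ProbabilityMeasure Z} {f : V → F} {post : Kernel Z F} {q : ℝ}
    (h : CorrectVia I f post q) (v : V) : 0 ≤ q :=
  (Real.iSup_nonneg fun _ => abs_nonneg _).trans (h v)

theorem CorrectVia.bind_le {V Z F : Type*} [MeasurableSpace Z] [MeasurableSpace F]
    {I : V → ProbabilityMeasure Z} {f : V → F} {post : Kernel Z F} [IsMarkovKernel post] {q : ℝ}
    (h : CorrectVia I f post q) (v : V) {E : Set F} (hE : MeasurableSet E) (hv : f v ∉ E) :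
    (I v : Measure Z).bind post E ≤ ENNReal.ofReal q := by
  have h1 := (abs_measureReal_sub_le_statDist ((I v : Measure Z).bind post)
    (Measure.dirac (f v)) hE).trans (h v)
  have h2 : (Measure.dirac (f v)).real E = 0 := by
    simp [Measure.real, Measure.dirac_apply' _ hE, hv]
  rw [h2, sub_zero, abs_of_nonneg measureReal_nonneg] at h1
  rw [← ofReal_measureReal (μ := (I v : Measure Z).bind post)]
  exact ENNReal.ofReal_le_ofReal h1

section

variable {n m g τ : ℕ} [NeZero n] [NeZero m] {lam : Set.Ioo (0 : ℝ) 1}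
  {Z : Type*} [MeasurableSpace Z] {I : Messages n (ZMod m) → ProbabilityMeasure Z}
  {post : Kernel Z (ZMod m)} [IsMarkovKernel post]

theorem outputLaw_apply (x : Fin n → Set.Icc (0 : ℝ) 1) {E : Set ℝ} (hE : MeasurableSet E) :
    (sumProtocol n m g τ lam I post).outputLaw x E =
      ∑ y, (sumProtocol n m g τ lam I post).messageLaw (Attack.absent n _) x y *
        (I (received y) : Measure Z).bind post (sumAnalyzer n m g τ ⁻¹' E) := by
  have hA : Measurable (sumAnalyzer n m g τ) := measurable_from_top
  rw [Protocol.outputLaw, Measure.bind_apply hE (Kernel.measurable _).aemeasurable,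
    Protocol.intermediaryLaw, lintegral_finsetSum_measure]
  refine Finset.sum_congr rfl fun y _ => ?_
  rw [lintegral_smul_measure, smul_eq_mul, Measure.bind_apply (hA hE) post.measurable.aemeasurable]
  congr 1
  refine lintegral_congr fun z => ?_
  exact Kernel.map_apply' post hA z hE

/-- For each message vector, the post-processed output leaves the exact sum with probability at most
`qI`. Averaging over the messages replaces that output by the true sum. -/
theorem outputLaw_le {qI : ℝ} (hI : CorrectVia I (aggregator m n) post qI)
    (x : Fin n → Set.Icc (0 : ℝ) 1) {E : Set ℝ} (hE : MeasurableSet E) :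
    (sumProtocol n m g τ lam I post).outputLaw x E ≤
      (sumLaw (sumProtocol n m g τ lam I post) (Attack.absent n _) x).toOuterMeasure
        (sumAnalyzer n m g τ ⁻¹' E) + ENNReal.ofReal qI := by
  classical
  have hA : Measurable (sumAnalyzer n m g τ) := measurable_from_top
  set P := sumProtocol n m g τ lam I post
  set F := sumAnalyzer n m g τ ⁻¹' E
  have hF : MeasurableSet F := hA hE
  have h : ∀ v, (I v : Measure Z).bind post F ≤
      (if aggregator m n v ∈ F then 1 else 0) + ENNReal.ofReal qI := by
    intro v
    split_ifs with hv
    · exact prob_le_one.trans le_self_add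
    · exact (hI.bind_le v hF hv).trans le_add_self
  rw [outputLaw_apply x hE]
  calc _ ≤ ∑ y, P.messageLaw (Attack.absent n _) x y *
          ((if aggregator m n (received y) ∈ F then 1 else 0) + ENNReal.ofReal qI) := by
        refine Finset.sum_le_sum fun y _ => ?_
        gcongr
        exact h _
    _ = _ := by
        rw [sum_messageLaw_mul P _ x fun s => (if s ∈ F then 1 else 0) + ENNReal.ofReal qI]
        simp only [mul_add, Finset.sum_add_distrib]
        have hsum : ∑ s, sumLaw P (Attack.absent n _) x s = 1 := by
          rw [← tsum_fintype (L := SummationFilter.unconditional _), PMF.tsum_coe]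
        rw [← Finset.sum_mul, hsum, one_mul, PMF.toOuterMeasure_apply_fintype]
        congr 1
        refine Finset.sum_congr rfl fun s _ => ?_
        simp [Set.indicator_apply]

/-- All `n` users are honest, so their parameters `2 / n` add up to 2 whatever `n` is. -/
theorem sumLaw_absent (x : Fin n → Set.Icc (0 : ℝ) 1) :
    sumLaw (sumProtocol n m g τ lam I post) (Attack.absent n _) x =
      ((∏ i, rounding g (x i)) * polyaNoise 2 lam two_pos lam.2).map
        (Int.castAddHom (ZMod m)) := by
  have h := prod_map_userLaw_honest (g := g) (τ := τ) (lam := lam) (I := I) (post := post)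
    (Attack.absent n _) x
  have hu : (Attack.absent n (ZMod m)).corruptedᶜ = Finset.univ := by simp [Attack.absent]
  have hn : (n : ℝ) ≠ 0 := Nat.cast_ne_zero.2 (NeZero.ne n)
  rw [hu, Finset.card_univ, Fintype.card_fin,
    polyaNoise_pow_of_mul_eq _ two_pos _ (NeZero.ne n) (mul_div_cancel₀ _ hn)] at h
  rw [sumLaw_eq_prod, h]

/-- The output of the protocol is accurate up to rounding errors and the tail of the noise. -/
theorem sumLaw_far_le [NeZero g] (hm : n * g + 3 * τ < m) {t : ℝ} (ht : t ∈ Set.Ioo (0 : ℝ) 1)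
    (hlam : (lam : ℝ) = t ^ 2) (x : Fin n → Set.Icc (0 : ℝ) 1) {δ : ℝ}
    (hδ : ((n : ℝ) + τ) / g ≤ δ) :
    (sumLaw (sumProtocol n m g τ lam I post) (Attack.absent n _) x).toOuterMeasure
      (sumAnalyzer n m g τ ⁻¹' {z | |z - ∑ i, (x i : ℝ)| ≤ δ}ᶜ) ≤
        2 * ENNReal.ofReal (4 * t ^ τ) := by
  have hg : (0 : ℝ) < g := Nat.cast_pos.2 (Nat.pos_of_neZero g)
  obtain ⟨lam, hlam'⟩ := lam
  change lam = t ^ 2 at hlam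
  subst hlam
  rw [sumLaw_absent, PMF.toOuterMeasure_map_apply, conv_def]
  have h0 : (∏ i, rounding g (x i)).toOuterMeasure ∅ = 0 := measure_empty
  -- The bad set is empty because the rounding error is bounded surely; only the noise can cause a
  -- failure.
  refine (toOuterMeasure_bind_le _ _ ∅ _ _ fun S hS _ => ?_).trans_eq (by rw [h0, zero_add])
  obtain ⟨φ, hφ, rfl⟩ := exists_of_mem_support_prod _ _ hS
  rw [PMF.toOuterMeasure_map_apply]
  refine le_trans (measure_mono fun z hz => ?_) (polyaNoise_tail ht hlam' τ)
  by_contra hz'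
  replace hz' : z.natAbs < τ := by simpa using hz'
  refine hz ?_
  have hφ' := fun i => mem_support_rounding_Icc (x i).2 (hφ i (Finset.mem_univ i))
  have hS0 : 0 ≤ ∑ i, φ i := Finset.sum_nonneg fun i _ => (hφ' i).1
  have hS1 : ∑ i, φ i ≤ n * g :=
    (Finset.sum_le_sum fun i _ => (hφ' i).2).trans_eq (by simp)
  have e : sumAnalyzer n m g τ (Int.castAddHom (ZMod m) (∑ i, φ i + z)) =
      ((∑ i, φ i + z : ℤ) : ℝ) / g := sumAnalyzer_intCast hm hS0 hS1 hz'.le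
  change |sumAnalyzer n m g τ (Int.castAddHom (ZMod m) (∑ i, φ i + z)) - ∑ i, (x i : ℝ)| ≤ δ
  rw [e]
  refine le_trans ?_ hδ
  rw [le_div_iff₀ hg, ← abs_of_pos hg, ← abs_mul, abs_of_pos hg, sub_mul, div_mul_cancel₀ _ hg.ne']
  have h1 : |∑ i, ((φ i : ℝ) - x i * g)| ≤ n :=
    (Finset.abs_sum_le_sum_abs _ _).trans ((Finset.sum_le_sum fun i _ =>
      abs_sub_le_of_mem_support_rounding (hφ i (Finset.mem_univ i))).trans_eq (by simp))
  have h2 : |(z : ℝ)| ≤ τ := by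
    rw [← Int.cast_abs, Int.abs_eq_natAbs]
    exact_mod_cast hz'.le
  have e2 : ((∑ i, φ i + z : ℤ) : ℝ) - (∑ i, (x i : ℝ)) * g =
      ∑ i, ((φ i : ℝ) - x i * g) + z := by
    push_cast
    rw [Finset.sum_sub_distrib, Finset.sum_mul]
    ring
  rw [e2]
  exact (abs_add_le _ _).trans (add_le_add h1 h2)

theorem le_outputLaw_real [NeZero g] (hm : n * g + 3 * τ < m) {t : ℝ} (ht : t ∈ Set.Ioo (0 : ℝ) 1)
    (hlam : (lam : ℝ) = t ^ 2) {qI q : ℝ} (hI : CorrectVia I (aggregator m n) post qI)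
    (x : Fin n → Set.Icc (0 : ℝ) 1) {δ : ℝ} (hδ : ((n : ℝ) + τ) / g ≤ δ) (hq : 4 * t ^ τ ≤ q) :
    1 - (qI + 2 * q) ≤
      ((sumProtocol n m g τ lam I post).outputLaw x).real {z | |z - ∑ i, (x i : ℝ)| ≤ δ} := by
  have hE : MeasurableSet {z : ℝ | |z - ∑ i, (x i : ℝ)| ≤ δ} :=
    (isClosed_le (by fun_prop) continuous_const).measurableSet
  set P := sumProtocol n m g τ lam I post with hP
  have : IsMarkovKernel P.analyzer := P.analyzer_markov
  have : IsProbabilityMeasure (P.outputLaw x) := by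
    unfold Protocol.outputLaw
    infer_instance
  have h0 : 0 ≤ 4 * t ^ τ := by have := ht.1; positivity
  -- Any message vector witnesses `0 ≤ qI`; the empty one always exists.
  have hqI := hI.nonneg ⟨[], by simp⟩
  have h := (outputLaw_le (g := g) (τ := τ) (lam := lam) hI x hE.compl).trans
    (add_le_add_left (sumLaw_far_le hm ht hlam x hδ) _)
  have h2 : (P.outputLaw x) {z | |z - ∑ i, (x i : ℝ)| ≤ δ}ᶜ ≤ ENNReal.ofReal (2 * q + qI) := by
    refine h.trans ?_
    rw [ENNReal.ofReal_add (by linarith) hqI, ENNReal.ofReal_mul two_pos.le,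
      ENNReal.ofReal_ofNat]
    gcongr
  have h3 : (P.outputLaw x).real {z | |z - ∑ i, (x i : ℝ)| ≤ δ}ᶜ ≤ 2 * q + qI :=
    ENNReal.toReal_le_of_le_ofReal (by linarith) h2
  rw [probReal_compl_eq_one_sub hE] at h3
  linarith

end

/-! ### Choice of the parameters -/

theorem exists_accurate_parameters {n : ℕ} [NeZero n] {ε q : ℝ} (hε : 0 < ε) (hε1 : ε < 1)
    (hq : 0 < q) :
    ∃ (g τ m : ℕ) (_ : NeZero g) (_ : NeZero m),
      ∀ (qI : ℝ) (Z : Type*) [MeasurableSpace Z]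
        (I : Messages n (ZMod m) → ProbabilityMeasure Z) (post : Kernel Z (ZMod m))
        [IsMarkovKernel post], CorrectVia I (aggregator m n) post qI →
          ∀ x : Fin n → Set.Icc (0 : ℝ) 1,
            1 - (qI + 3 * q) ≤
              ((sumProtocol n m g τ (noiseParam ε hε g) I post).outputLaw x).real
                {z | |z - ∑ i, (x i : ℝ)| ≤ 8 * (1 / ε * Real.log (1 / q))} := by
  have hn1 : (1 : ℝ) ≤ n := by exact_mod_cast Nat.pos_of_neZero n
  have hn : (0 : ℝ) < n := by linarith
  obtain ⟨τ, hτ⟩ : ∃ τ : ℕ, τ = ⌈2 * n / ε * Real.log (4 / q)⌉₊ := ⟨_, rfl⟩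
  -- With `g = n` the total rounding error is at most `n / g = 1`. For `t = exp (-ε / (2n))`, which
  -- satisfies `t ^ 2 = λ`, this `τ` is the least natural number with `4 * t ^ τ ≤ q`. The modulus
  -- is the smallest one exceeding `n * g + 3 * τ`.
  refine ⟨n, τ, n * n + 3 * τ + 1, inferInstance, inferInstance, ?_⟩
  intro qI Z _ I post _ hI x
  -- For `q ≥ 1/3` the claimed probability is at most zero. Otherwise `q < 1/3 < 1/e`, so `ln (1/q)
  -- ≥ 1` and additive constants can be absorbed into the error bound.
  rcases le_or_gt (1 / 3) q with h3 | h3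
  · have hqI := hI.nonneg ⟨[], by simp⟩
    exact le_trans (by linarith) measureReal_nonneg
  have hlog : 1 ≤ Real.log (1 / q) := by
    rw [Real.le_log_iff_exp_le (by positivity), le_div_iff₀ hq]
    have := Real.exp_one_lt_d9
    nlinarith
  have hlog4 : Real.log (4 / q) ≤ 1.4 + Real.log (1 / q) := by
    have h4 : Real.log 4 = 2 * Real.log 2 := by
      rw [← Real.log_rpow two_pos]
      norm_num
    have := Real.log_two_lt_d9
    rw [show 4 / q = 4 * (1 / q) by ring, Real.log_mul (by norm_num) (by positivity), h4]
    linarith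
  have hlog0 : 0 ≤ Real.log (4 / q) := Real.log_nonneg (by rw [le_div_iff₀ hq]; linarith)
  have hceil : (τ : ℝ) < 2 * n / ε * Real.log (4 / q) + 1 := by
    rw [hτ]
    exact Nat.ceil_lt_add_one (by positivity)
  have hle : 2 * n / ε * Real.log (4 / q) ≤ τ := by
    rw [hτ]
    exact Nat.le_ceil _
  refine le_trans ?_ (le_outputLaw_real (g := n) (τ := τ) (t := Real.exp (-(ε / (2 * n)))) (q := q)
    (by omega) ⟨Real.exp_pos _, Real.exp_lt_one_iff.2 (neg_lt_zero.2 (by positivity))⟩ ?_ hI x ?_ ?_)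
  · linarith
  · rw [← Real.exp_nat_mul, noiseParam]
    push_cast
    field_simp
  -- Write `L = ln (1/q) / ε ≥ 1`. As `ln (4/q) ≤ 1.4 + ln (1/q) ≤ 2.4 * ln (1/q)`, the error `(n +
  -- τ) / n` is at most `2 + 4.8 * L ≤ 6.8 * L`, which is below `8 * L`.
  · have hL : 1 ≤ 1 / ε := by rw [le_div_iff₀ hε]; linarith
    rw [div_le_iff₀ hn]
    have e : 2 * n / ε * Real.log (4 / q) = n * (2 * (1 / ε) * Real.log (4 / q)) := by ring
    rw [e] at hceil
    have h1 : 2 * (1 / ε) * Real.log (4 / q) ≤ 2 * (1 / ε) * (2.4 * Real.log (1 / q)) := by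
      gcongr
      linarith
    have h2 : 1 ≤ 1 / ε * Real.log (1 / q) := by nlinarith
    have h4 : (n : ℝ) * (2 * (1 / ε) * Real.log (4 / q)) ≤
        n * (4.8 * (1 / ε * Real.log (1 / q))) :=
      mul_le_mul_of_nonneg_left (h1.trans_eq (by ring)) hn.le
    nlinarith
  · rw [← Real.exp_nat_mul]
    have h1 : (τ : ℝ) * -(ε / (2 * n)) ≤ -Real.log (4 / q) := by
      have := mul_le_mul_of_nonneg_right hle (by positivity : 0 ≤ ε / (2 * n))
      have e : 2 * n / ε * Real.log (4 / q) * (ε / (2 * n)) = Real.log (4 / q) := by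
        field_simp
      linarith
    calc 4 * Real.exp (τ * -(ε / (2 * n))) ≤ 4 * Real.exp (-Real.log (4 / q)) := by gcongr
      _ = q := by
        rw [Real.exp_neg, Real.exp_log (by positivity)]
        field_simp

end

end SecureSum

theorem theorem4p1 :
    -- robust privacy, for all parameters
    (∀ (n m g τ : ℕ) [NeZero n] [NeZero m] [NeZero g] (ε : ℝ) (hε : 0 < ε), ε < 1 →
      ∀ (εI qI : ℝ) (Z : Type*) [MeasurableSpace Z]
        (I : Messages n (ZMod m) → ProbabilityMeasure Z) (post : Kernel Z (ZMod m))
        [IsMarkovKernel post],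
        IsRelaxation I (aggregator m n) εI qI →
        (sumProtocol n m g τ (noiseParam ε hε g) I post).RobustlyDP (2 * εI + ε)) ∧
    -- accuracy, for suitable parameters
    (∃ K : ℝ, 0 < K ∧
      ∀ (n : ℕ) [NeZero n] (ε q : ℝ) (hε : 0 < ε), ε < 1 → 0 < q → q < 1 →
        ∃ (g τ m : ℕ) (_ : NeZero g) (_ : NeZero m),
          ∀ (εI qI : ℝ) (Z : Type*) [MeasurableSpace Z]
            (I : Messages n (ZMod m) → ProbabilityMeasure Z) (post : Kernel Z (ZMod m))
            [IsMarkovKernel post],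
            IsRelaxation I (aggregator m n) εI qI → CorrectVia I (aggregator m n) post qI →
            ∀ x : Fin n → Set.Icc (0 : ℝ) 1,
              1 - (qI + 3 * q) ≤
                ((sumProtocol n m g τ (noiseParam ε hε g) I post).outputLaw x).real
                  {z | |z - ∑ i, (x i : ℝ)| ≤ K * (1 / ε * Real.log (1 / q))}) := by
  refine ⟨?_, 8, by norm_num, ?_⟩
  · intro n m g τ _ _ _ ε hε _ εI qI Z _ I post _ hI
    exact robustlyDP_sumProtocol hε post hI.1
  · intro n _ ε q hε hε1 hq _
    obtain ⟨g, τ, m, hg, hm, h⟩ := exists_accurate_parameters (n := n) hε hε1 hq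
    exact ⟨g, τ, m, hg, hm, fun εI qI Z _ I post _ _ hI x => h qI Z I post hI x⟩
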